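/- Let $Z$ be a smooth manifold (Hausdorff, second countable, without boundary) with 2-jet bundle $J^2(Z)$, the vector bundle whose fibre in a chart consists of the coordinate 2-jets $(r,p,A)=(u,Du,D^2u)$. For $z\in Z$ regard $\mathrm{Sym}^2(T_z^*Z)\subset J^2_z(Z)$ as the 2-jets $(0,0,A)$ of functions with critical value zero at $z$. A *subequation* on $Z$ is a closed subset $F\subset J^2(Z)$ such that $F_z+P\subset F_z$ for every $z\in Z$ and every quadratic form $P\ge 0$ on $T_zZ$, where $F_z=F\cap J^2_z(Z)$; it has the *cone property* if $tF_z\subset F_z$ for all $z\in Z$ and $t>0$. Put $(F_z)_0=F_z\cap \mathrm{Sym}^2(T_z^*Z)$. A submanifold $X\subset Z$ is *totally $F$-free* if for each $x\in X$ there is an $A\in (F_x)_0$ whose restriction to $T_xX$ is negative definite. A $C^2$ function $f$ on an open set $U\subset Z$ is *strictly $F$-subharmonic* if its 2-jet at each point of $U$ lies in $\mathrm{Int}\,F$, the interior of $F$ in $J^2(Z)$. **Theorem.** Let $F$ be a subequation on $Z$ with the cone property, and let $X\subset Z$ be a closed (smooth, embedded) totally $F$-free submanifold. Assume that $\mathrm{Int}\,(F_x)_0\subset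 \mathrm{Int}\,F$ for each $x\in X$, where $\mathrm{Int}\,(F_x)_0$ is the interior of $(F_x)_0$ in $\mathrm{Sym}^2(T_x^*Z)$. Then for every $u\in C^2(X)$ there are an open neighbourhood $U$ of $X$ in $Z$ and a strictly $F$-subharmonic function $\widetilde u\in C^2(U)$ with $\widetilde u|_X=u$. -/

import Mathlib

open Set Topology Bundle Manifold
open scoped ContDiff

noncomputable section

/-! ### Symmetric forms and the fibre of the 2-jet bundle -/

/-- Subspaces of a real normed space. This only abbreviates `Submodule ℝ V`; it makes the instances
on `V` be found through its norm. -/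
abbrev NormedSubspace (V : Type*) [NormedAddCommGroup V] [NormedSpace ℝ V] : Type _ :=
  Submodule ℝ V

/-- The space of symmetric bilinear forms (equivalently, quadratic forms) on `E`. -/
def SymForm (E : Type*) [NormedAddCommGroup E] [NormedSpace ℝ E] :
    NormedSubspace (E →L[ℝ] E →L[ℝ] ℝ) where
  carrier := {A | ∀ v w, A v w = A w v}
  add_mem' := by
    intro A B hA hB v w
    simp [hA v w, hB v w]
  zero_mem' := by
    intro v w
    simp
  smul_mem' := by
    intro c A hA v w
    simp [hA v w]

/-- Symmetrization of a bilinear form; it fixes the symmetric ones. It is applied below to second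
derivatives of `C²` functions, which are already symmetric. -/
def SymForm.symm {E : Type*} [NormedAddCommGroup E] [NormedSpace ℝ E] :
    (E →L[ℝ] E →L[ℝ] ℝ) →ₗ[ℝ] SymForm E where
  toFun A := ⟨(2⁻¹ : ℝ) • (A + A.flip), by
    intro v w
    change (2⁻¹ : ℝ) * (A v w + A w v) = (2⁻¹ : ℝ) * (A w v + A v w)
    ring⟩
  map_add' A B := by
    ext v w
    change (2⁻¹ : ℝ) * (A v w + B v w + (A w v + B w v)) =
      (2⁻¹ : ℝ) * (A v w + A w v) + (2⁻¹ : ℝ) * (B v w + B w v)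
    ring
  map_smul' c A := by
    ext v w
    change (2⁻¹ : ℝ) * (c * A v w + c * A w v) = c * ((2⁻¹ : ℝ) * (A v w + A w v))
    ring

theorem SymForm.coe_symm_apply {E : Type*} [NormedAddCommGroup E] [NormedSpace ℝ E]
    (A : E →L[ℝ] E →L[ℝ] ℝ) (v w : E) :
    (SymForm.symm A).1 v w = 2⁻¹ * (A v w + A w v) := rfl

theorem SymForm.symm_of_mem {E : Type*} [NormedAddCommGroup E] [NormedSpace ℝ E]
    (A : SymForm E) : SymForm.symm A.1 = A := by
  apply Subtype.ext
  ext v w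
  rw [SymForm.coe_symm_apply, A.2 w v]
  ring

/-- The fibre `ℝ × E* × Sym²(E*)` of the 2-jets `(r, p, A)` in a chart with values in `E`. -/
abbrev JetModel (E : Type*) [NormedAddCommGroup E] [NormedSpace ℝ E] : Type _ :=
  ℝ × (E →L[ℝ] ℝ) × SymForm E

/-- The coordinate 2-jet at `y` of a function `f` on a vector space: value, first derivative and
second derivative. -/
def coordJet {E : Type*} [NormedAddCommGroup E] [NormedSpace ℝ E] (f : E → ℝ) (y : E) :
    JetModel E :=
  (f y, fderiv ℝ f y, SymForm.symm (fderiv ℝ (fderiv ℝ f) y))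

section

variable {E : Type*} [NormedAddCommGroup E] [NormedSpace ℝ E] [FiniteDimensional ℝ E]

/-- The action on 2-jets of a change of variables with first derivative `B` and second
derivative `C`: `(r, p, A) ↦ (r, p ∘ B, A(B ·, B ·) + p ∘ C)`, by the chain rule. -/
def jetPull (B : E →L[ℝ] E) (C : E →L[ℝ] E →L[ℝ] E) : JetModel E →L[ℝ] JetModel E :=
  LinearMap.toContinuousLinearMap
    { toFun := fun J => (J.1, J.2.1.comp B, SymForm.symm
        (J.2.2.1.bilinearComp B B + (ContinuousLinearMap.compL ℝ E E ℝ J.2.1).comp C))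
      map_add' := by
        intro J K
        refine Prod.ext rfl (Prod.ext ?_ (Subtype.ext ?_))
        · ext v
          simp
        · ext v w
          change (2⁻¹ : ℝ) * (J.2.2.1 (B v) (B w) + K.2.2.1 (B v) (B w) +
              (J.2.1 (C v w) + K.2.1 (C v w)) + (J.2.2.1 (B w) (B v) + K.2.2.1 (B w) (B v) +
              (J.2.1 (C w v) + K.2.1 (C w v)))) =
            (2⁻¹ : ℝ) * (J.2.2.1 (B v) (B w) + J.2.1 (C v w) +
              (J.2.2.1 (B w) (B v) + J.2.1 (C w v))) +
            (2⁻¹ : ℝ) * (K.2.2.1 (B v) (B w) + K.2.1 (C v w) +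
              (K.2.2.1 (B w) (B v) + K.2.1 (C w v)))
          ring
      map_smul' := by
        intro c J
        refine Prod.ext rfl (Prod.ext ?_ (Subtype.ext ?_))
        · ext v
          simp
        · ext v w
          change (2⁻¹ : ℝ) * (c * J.2.2.1 (B v) (B w) + c * J.2.1 (C v w) +
              (c * J.2.2.1 (B w) (B v) + c * J.2.1 (C w v))) =
            c * ((2⁻¹ : ℝ) * (J.2.2.1 (B v) (B w) + J.2.1 (C v w) +
              (J.2.2.1 (B w) (B v) + J.2.1 (C w v))))
          ring }

theorem jetPull_apply (B : E →L[ℝ] E) (C : E →L[ℝ] E →L[ℝ] E) (J : JetModel E) :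
    jetPull B C J = (J.1, J.2.1.comp B, SymForm.symm
      (J.2.2.1.bilinearComp B B + (ContinuousLinearMap.compL ℝ E E ℝ J.2.1).comp C)) := rfl

theorem jetPull_form_apply (B : E →L[ℝ] E) (C : E →L[ℝ] E →L[ℝ] E) (J : JetModel E) (v w : E) :
    (jetPull B C J).2.2.1 v w = 2⁻¹ * (J.2.2.1 (B v) (B w) + J.2.1 (C v w) +
      (J.2.2.1 (B w) (B v) + J.2.1 (C w v))) := rfl

/-- The 2-jet change of coordinates of a map `ψ : E → E` at `y`. -/
def jetChange (ψ : E → E) (y : E) : JetModel E →L[ℝ] JetModel E :=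
  jetPull (fderiv ℝ ψ y) (fderiv ℝ (fderiv ℝ ψ) y)

theorem jetChange_congr {ψ φ : E → E} {y : E} (h : ψ =ᶠ[𝓝 y] φ) :
    jetChange ψ y = jetChange φ y := by
  unfold jetChange
  rw [h.fderiv_eq, h.fderiv.fderiv_eq]

theorem jetChange_id (y : E) (J : JetModel E) : jetChange (fun x : E => x) y J = J := by
  have h : fderiv ℝ (fun x : E => x) = fun _ => ContinuousLinearMap.id ℝ E := by
    ext x v
    simp
  unfold jetChange
  rw [h, jetPull_apply]
  refine Prod.ext rfl (Prod.ext ?_ (Subtype.ext ?_))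
  · ext v
    simp
  · ext v w
    simp [SymForm.coe_symm_apply, J.2.2.2 w v]
    ring

/-- Second-order chain rule. -/
theorem fderiv_fderiv_comp_apply {E : Type*} [NormedAddCommGroup E] [NormedSpace ℝ E]
    {G : Type*} [NormedAddCommGroup G] [NormedSpace ℝ G]
    {f : E → G} {g : E → E} {y : E} (hf : ContDiffAt ℝ 2 f (g y)) (hg : ContDiffAt ℝ 2 g y)
    (v w : E) :
    fderiv ℝ (fderiv ℝ (f ∘ g)) y v w =
      fderiv ℝ (fderiv ℝ f) (g y) (fderiv ℝ g y v) (fderiv ℝ g y w) +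
        fderiv ℝ f (g y) (fderiv ℝ (fderiv ℝ g) y v w) := by
  have e : fderiv ℝ (f ∘ g) =ᶠ[𝓝 y] fun x => (fderiv ℝ f (g x)).comp (fderiv ℝ g x) := by
    have h1 : ∀ᶠ x in 𝓝 y, ContDiffAt ℝ 2 g x := hg.eventually (by simp)
    have h2 : ∀ᶠ x in 𝓝 y, ContDiffAt ℝ 2 f (g x) :=
      hg.continuousAt.eventually (hf.eventually (by simp))
    filter_upwards [h1, h2] with x hx1 hx2
    exact fderiv_comp x (hx2.differentiableAt (by simp)) (hx1.differentiableAt (by simp))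
  have df : DifferentiableAt ℝ (fderiv ℝ f) (g y) :=
    (hf.fderiv_right (m := 1) (by norm_num)).differentiableAt (by simp)
  have dg : DifferentiableAt ℝ (fderiv ℝ g) y :=
    (hg.fderiv_right (m := 1) (by norm_num)).differentiableAt (by simp)
  have dg0 : DifferentiableAt ℝ g y := hg.differentiableAt (by simp)
  have h : HasFDerivAt (fun x => fderiv ℝ f (g x))
      ((fderiv ℝ (fderiv ℝ f) (g y)).comp (fderiv ℝ g y)) y :=
    HasFDerivAt.comp y df.hasFDerivAt dg0.hasFDerivAt
  rw [e.fderiv_eq, (h.clm_comp dg.hasFDerivAt).fderiv]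
  simp [add_comm]

/-- Functoriality of the 2-jet change of coordinates. -/
theorem jetChange_comp {f g : E → E} {y : E} (hf : ContDiffAt ℝ 2 f (g y))
    (hg : ContDiffAt ℝ 2 g y) (J : JetModel E) :
    jetChange g y (jetChange f (g y) J) = jetChange (f ∘ g) y J := by
  have h1 : fderiv ℝ (f ∘ g) y = (fderiv ℝ f (g y)).comp (fderiv ℝ g y) :=
    fderiv_comp y (hf.differentiableAt (by simp)) (hg.differentiableAt (by simp))
  unfold jetChange
  refine Prod.ext rfl (Prod.ext ?_ (Subtype.ext ?_))
  · ext v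
    simp [jetPull_apply, h1]
  · ext v w
    rw [jetPull_form_apply, jetPull_form_apply, jetPull_form_apply, jetPull_form_apply,
      fderiv_fderiv_comp_apply hf hg, fderiv_fderiv_comp_apply hf hg, h1]
    simp only [jetPull_apply, ContinuousLinearMap.comp_apply, map_add]
    ring

theorem continuousOn_jetChange {f : E → E} {s : Set E} (hs : IsOpen s)
    (hf : ContDiffOn ℝ 2 f s) : ContinuousOn (jetChange f) s := by
  have c1 : ContinuousOn (fderiv ℝ f) s := hf.continuousOn_fderiv_of_isOpen hs (by simp)
  have c2 : ContinuousOn (fderiv ℝ (fderiv ℝ f)) s :=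
    (hf.fderiv_of_isOpen (m := 1) hs (by norm_num)).continuousOn_fderiv_of_isOpen hs (by simp)
  refine (continuousOn_clm_apply (𝕜 := ℝ) (E := JetModel E) (F := JetModel E)).2 fun J => ?_
  refine continuousOn_const.prodMk ((continuousOn_const.clm_comp c1).prodMk
    (IsInducing.subtypeVal.continuousOn_iff.2 ?_))
  refine (continuousOn_clm_apply (𝕜 := ℝ) (E := E) (F := E →L[ℝ] ℝ)).2 fun v => ?_
  refine (continuousOn_clm_apply (𝕜 := ℝ) (E := E) (F := ℝ)).2 fun w => ?_
  have c1' (v : E) := c1.clm_apply (continuousOn_const (c := v))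
  have c2' (v w : E) :=
    (c2.clm_apply (continuousOn_const (c := v))).clm_apply (continuousOn_const (c := w))
  have c3 (v w : E) : ContinuousOn (fun y => J.2.2.1 (fderiv ℝ f y v) (fderiv ℝ f y w) +
      J.2.1 (fderiv ℝ (fderiv ℝ f) y v w)) s :=
    ((J.2.2.1.continuous.comp_continuousOn (c1' v)).clm_apply (c1' w)).add
      (J.2.1.continuous.comp_continuousOn (c2' v w))
  exact continuousOn_const.mul ((c3 v w).add (c3 w v))

end

/-! ### The 2-jet bundle of a manifold -/

section

variable (E : Type*) [NormedAddCommGroup E] [NormedSpace ℝ E]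
  (Z : Type*) [TopologicalSpace Z] [ChartedSpace E Z] [IsManifold 𝓘(ℝ, E) ∞ Z]

theorem contDiffOn_transition (i j : atlas E Z) :
    ContDiffOn ℝ 2 (i.1 ∘ j.1.symm) (j.1.symm.trans i.1).source := by
  have h := (contDiffGroupoid ∞ 𝓘(ℝ, E)).compatible j.2 i.2
  have h' := (contDiffGroupoid_le (I := 𝓘(ℝ, E)) (m := 2) (n := ∞)
    ENat.LEInfty.out) h
  rw [contDiffGroupoid] at h'
  have h2 := (mem_groupoid_of_pregroupoid.1 h').1
  simpa [contDiffPregroupoid] using h2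

theorem contDiffAt_transition (i j : atlas E Z) {z : Z} (hi : z ∈ i.1.source)
    (hj : z ∈ j.1.source) : ContDiffAt ℝ 2 (i.1 ∘ j.1.symm) (j.1 z) := by
  refine (contDiffOn_transition E Z i j).contDiffAt
    ((OpenPartialHomeomorph.open_source _).mem_nhds ?_)
  simp [hi, hj]

variable [FiniteDimensional ℝ E]

/-- The bundle of 2-jets of real functions on the manifold `Z`: in each chart of the atlas it is
trivialized with fibre `ℝ × E* × Sym²(E*)`, and two charts are glued by the chain rule to
second order. As for the tangent bundle, the fibre at `z` is identified with the model fibre through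
the preferred chart at `z`. -/
def jetBundleCore : VectorBundleCore ℝ Z (JetModel E) (atlas E Z) where
  baseSet i := i.1.source
  isOpen_baseSet i := i.1.open_source
  indexAt := achart E
  mem_baseSet_at := mem_chart_source E
  coordChange i j z := jetChange (i.1 ∘ j.1.symm) (j.1 z)
  coordChange_self := by
    intro i z hz J
    have h : i.1 ∘ i.1.symm =ᶠ[𝓝 (i.1 z)] fun x => x := by
      filter_upwards [i.1.open_target.mem_nhds (i.1.map_source hz)] with y hy
      exact i.1.right_inv hy
    rw [jetChange_congr h, jetChange_id]
  continuousOn_coordChange := by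
    intro i j
    refine (continuousOn_jetChange (OpenPartialHomeomorph.open_source _)
      (contDiffOn_transition E Z i j)).comp (j.1.continuousOn.mono inter_subset_right) ?_
    intro z hz
    simp [hz.1, hz.2]
  coordChange_comp := by
    rintro i j k z ⟨⟨hi, hj⟩, hk⟩ J
    have hjk : (j.1 ∘ k.1.symm) (k.1 z) = j.1 z := by simp [hk]
    have h : (i.1 ∘ j.1.symm) ∘ (j.1 ∘ k.1.symm) =ᶠ[𝓝 (k.1 z)] i.1 ∘ k.1.symm := by
      have : ∀ᶠ y in 𝓝 (k.1 z), k.1.symm y ∈ j.1.source :=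
        (k.1.continuousAt_symm (k.1.map_source hk)).eventually
          (j.1.open_source.mem_nhds (by simpa [hk] using hj))
      filter_upwards [this] with y hy
      simp [j.1.left_inv hy]
    rw [← jetChange_congr h, ← jetChange_comp, hjk]
    · rw [hjk]
      exact contDiffAt_transition E Z i j hi hj
    · exact contDiffAt_transition E Z j k hj hk

/-- The fibre `J²_z(Z)` of 2-jets at `z`, a finite-dimensional real vector space. -/
abbrev JetFiber (z : Z) : Type _ := (jetBundleCore E Z).Fiber z

/-- The total space of the 2-jet bundle `J²(Z)`, with its topology of a vector bundle. -/
abbrev JetBundle : Type _ := (jetBundleCore E Z).TotalSpace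

variable {Z}

/-- The 2-jet at `z` of a function `f : Z → ℝ` which is `C²` near `z`. -/
def jetAt (f : Z → ℝ) (z : Z) : JetFiber E Z z :=
  coordJet (f ∘ (chartAt E z).symm) (chartAt E z z)

/-- The embedding `Sym²(T_z^* Z) → J²_z(Z)`, `A ↦ (0, 0, A)`, onto the 2-jets of functions with
critical value zero at `z`. As in Mathlib, the tangent space `T_z Z` is `E`, identified through the
preferred chart at `z`, which is also the one used for the fibre of the 2-jet bundle. -/
def symJet (z : Z) (A : SymForm E) : JetFiber E Z z :=
  ((0, 0, A) : JetModel E)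

/-- The fibre `F_z` of a subset `F` of the 2-jet bundle. -/
def jetSlice (F : Set (JetBundle E Z)) (z : Z) : Set (JetFiber E Z z) :=
  {J | (⟨z, J⟩ : JetBundle E Z) ∈ F}

/-- `(F_z)_0 = F_z ∩ Sym²(T_z^* Z)`. -/
def symSlice (F : Set (JetBundle E Z)) (z : Z) : Set (SymForm E) :=
  {A | symJet E z A ∈ jetSlice E F z}

/-- A subequation: a closed subset `F` of the 2-jet bundle such that `F_z + P ⊆ F_z` for every
quadratic form `P ≥ 0` on `T_z Z`. -/
structure IsSubequation (F : Set (JetBundle E Z)) : Prop where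
  isClosed : IsClosed F
  positivity : ∀ (z : Z), ∀ J ∈ jetSlice E F z, ∀ P : SymForm E,
    (∀ v, 0 ≤ P.1 v v) → J + symJet E z P ∈ jetSlice E F z

/-- The cone property: each fibre is a cone with vertex at the origin. -/
def HasConeProperty (F : Set (JetBundle E Z)) : Prop :=
  ∀ (z : Z), ∀ J ∈ jetSlice E F z, ∀ t : ℝ, 0 < t → t • J ∈ jetSlice E F z

/-- A `C²` function `f` on an open set `U` is strictly `F`-subharmonic if its 2-jet at each point of
`U` lies in the interior of `F` in the total space of the 2-jet bundle. -/
structure IsStrictlySubharmonicOn (F : Set (JetBundle E Z)) (f : Z → ℝ) (U : Set Z) : Prop where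
  contMDiffOn : ContMDiffOn 𝓘(ℝ, E) 𝓘(ℝ, ℝ) 2 f U
  jet_mem : ∀ z ∈ U, (⟨z, jetAt E f z⟩ : JetBundle E Z) ∈ interior F

/-- A subspace `W` is totally free for a set `F₀` of quadratic forms if some element of `F₀` is
negative definite on `W` (that is, `W` is `F₀`-Morse). -/
def IsTotallyFreeSubspace {T : Type*} [NormedAddCommGroup T] [NormedSpace ℝ T]
    (F₀ : Set (SymForm T)) (W : Submodule ℝ T) : Prop :=
  ∃ A ∈ F₀, ∀ w ∈ W, w ≠ 0 → A.1 w w < 0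

/-- An immersed manifold `i : X → Z` is totally `F`-free if each tangent space `T_x X`, that is, the
image of the differential of `i` at `x`, is totally `(F_{i x})_0`-free. -/
def IsTotallyFree (F : Set (JetBundle E Z)) {E' : Type*} [NormedAddCommGroup E']
    [NormedSpace ℝ E'] {X : Type*} [TopologicalSpace X] [ChartedSpace E' X] (i : X → Z) : Prop :=
  ∀ x : X, IsTotallyFreeSubspace (symSlice E F (i x))
    (LinearMap.range (mfderiv 𝓘(ℝ, E') 𝓘(ℝ, E) i x).toLinearMap)

end

end

/-!
Local retractions onto `X` and a partition of unity extend `u` to a `C²` function `w` on `Z`, and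
glue squared norms of normal coordinates to a `C²` function `g` that vanishes to first order on `X`
and has there a nonnegative Hessian `P` whose null directions are tangent to `X`. If `A ∈ (F_x)_0`
is negative definite on the tangent space, then `P - t A` is positive definite for small `t > 0`
(Finsler), so `P` is interior to `(F_x)_0` by positivity and the cone property, and hence the 2-jet
of `g` lies in `Int F` along `X`. The cone property then gives a function `l` with
`J²w + l J²g = l (J²w / l + J²g) ∈ Int F` along `X`. This is the 2-jet of `w + l g`, since `g` is
critical with value zero on `X`.
-/

section SecondDerivative

variable {𝕜 : Type*} [NontriviallyNormedField 𝕜]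
  {E : Type*} [NormedAddCommGroup E] [NormedSpace 𝕜 E]
  {F : Type*} [NormedAddCommGroup F] [NormedSpace 𝕜 F]
  {G : Type*} [NormedAddCommGroup G] [NormedSpace 𝕜 G]
  {H : Type*} [NormedAddCommGroup H] [NormedSpace 𝕜 H]
  {f : E → F} {g : E → G} {y : E}

theorem differentiableAt_fderiv (hf : ContDiffAt 𝕜 2 f y) :
    DifferentiableAt 𝕜 (fderiv 𝕜 f) y :=
  (hf.fderiv_right (m := 1) (by norm_num)).differentiableAt (by simp)

theorem eventually_differentiableAt (hf : ContDiffAt 𝕜 2 f y) :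
    ∀ᶠ x in 𝓝 y, DifferentiableAt 𝕜 f x :=
  (hf.eventually (by simp)).mono fun _ hx => hx.differentiableAt (by simp)

theorem fderiv_fderiv_add (hf : ContDiffAt 𝕜 2 f y) {g : E → F} (hg : ContDiffAt 𝕜 2 g y) :
    fderiv 𝕜 (fderiv 𝕜 (f + g)) y = fderiv 𝕜 (fderiv 𝕜 f) y + fderiv 𝕜 (fderiv 𝕜 g) y := by
  have h : fderiv 𝕜 (f + g) =ᶠ[𝓝 y] fderiv 𝕜 f + fderiv 𝕜 g := by
    filter_upwards [eventually_differentiableAt hf, eventually_differentiableAt hg]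
      with x hfx hgx using fderiv_add hfx hgx
  rw [h.fderiv_eq, fderiv_add (differentiableAt_fderiv hf) (differentiableAt_fderiv hg)]

theorem fderiv_fderiv_bilinear_apply (B : F →L[𝕜] G →L[𝕜] H) (hf : ContDiffAt 𝕜 2 f y)
    (hg : ContDiffAt 𝕜 2 g y) (v w : E) :
    fderiv 𝕜 (fderiv 𝕜 fun x => B (f x) (g x)) y v w =
      B (f y) (fderiv 𝕜 (fderiv 𝕜 g) y v w) + B (fderiv 𝕜 f y v) (fderiv 𝕜 g y w) +
        (B (fderiv 𝕜 f y w) (fderiv 𝕜 g y v) + B (fderiv 𝕜 (fderiv 𝕜 f) y v w) (g y)) := by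
  have h : fderiv 𝕜 (fun x => B (f x) (g x)) =ᶠ[𝓝 y]
      fun x => B.precompR E (f x) (fderiv 𝕜 g x) + B.precompL E (fderiv 𝕜 f x) (g x) := by
    filter_upwards [eventually_differentiableAt hf, eventually_differentiableAt hg]
      with x hfx hgx using B.fderiv_of_bilinear hfx hgx
  have hf' := (hf.differentiableAt (by simp)).hasFDerivAt
  have hg' := (hg.differentiableAt (by simp)).hasFDerivAt
  have hf'' := (differentiableAt_fderiv hf).hasFDerivAt
  have hg'' := (differentiableAt_fderiv hg).hasFDerivAt
  rw [h.fderiv_eq, (((B.precompR E).hasFDerivAt_of_bilinear hf' hg'').fun_add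
    ((B.precompL E).hasFDerivAt_of_bilinear hf'' hg')).fderiv]
  simp

end SecondDerivative

section CoordJet

variable {E : Type*} [NormedAddCommGroup E] [NormedSpace ℝ E] {f g : E → ℝ} {y : E}

theorem coordJet_congr (h : f =ᶠ[𝓝 y] g) : coordJet f y = coordJet g y := by
  simp only [coordJet, h.eq_of_nhds, h.fderiv_eq, h.fderiv.fderiv_eq]

theorem coordJet_zero : coordJet (0 : E → ℝ) y = 0 := by
  simp [coordJet]

theorem coordJet_add (hf : ContDiffAt ℝ 2 f y) (hg : ContDiffAt ℝ 2 g y) :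
    coordJet (f + g) y = coordJet f y + coordJet g y := by
  rw [coordJet, fderiv_fderiv_add hf hg, map_add,
    fderiv_add (hf.differentiableAt (by simp)) (hg.differentiableAt (by simp))]
  rfl

theorem coordJet_mul_of_critical (hf : ContDiffAt ℝ 2 f y) (hg : ContDiffAt ℝ 2 g y)
    (h0 : g y = 0) (h1 : fderiv ℝ g y = 0) : coordJet (f * g) y = f y • coordJet g y := by
  have h2 : fderiv ℝ (fderiv ℝ (f * g)) y = f y • fderiv ℝ (fderiv ℝ g) y := by
    ext v w
    refine (fderiv_fderiv_bilinear_apply (ContinuousLinearMap.mul ℝ ℝ) hf hg v w).trans ?_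
    simp [h0, h1]
  rw [coordJet, h2, map_smul,
    fderiv_mul (hf.differentiableAt (by simp)) (hg.differentiableAt (by simp))]
  simp [coordJet, h0, h1]

theorem exists_coordJet_norm_sq {G : Type*} [NormedAddCommGroup G] [InnerProductSpace ℝ G]
    {N : E → G} (hN : ContDiffAt ℝ 2 N y) (h0 : N y = 0) :
    ∃ P : SymForm E, coordJet (fun x => ‖N x‖ ^ 2) y = (0, 0, P) ∧
      ∀ v, P.1 v v = 2 * ‖fderiv ℝ N y v‖ ^ 2 := by
  refine ⟨_, Prod.ext (by simp [coordJet, h0]) (Prod.ext ?_ rfl), fun v => ?_⟩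
  · change fderiv ℝ (fun x => ‖N x‖ ^ 2) y = 0
    rw [(hN.differentiableAt (by simp)).hasFDerivAt.norm_sq.fderiv]
    ext v
    simp [h0]
  · have h := fderiv_fderiv_bilinear_apply
      (isBoundedBilinearMap_inner (𝕜 := ℝ) (E := G)).toContinuousLinearMap hN hN v v
    simp only [IsBoundedBilinearMap.toContinuousLinearMap_apply, real_inner_self_eq_norm_sq, h0,
      inner_zero_left, inner_zero_right] at h
    rw [coordJet, SymForm.coe_symm_apply, h]
    ring

theorem continuousAt_coordJet (hf : ContDiffAt ℝ 2 f y) : ContinuousAt (coordJet f) y := by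
  have h1 : ContDiffAt ℝ 1 (fderiv ℝ f) y := hf.fderiv_right (m := 1) (by norm_num)
  have h2 : ContinuousAt (fderiv ℝ (fderiv ℝ f)) y :=
    (h1.fderiv_right (m := 0) (by norm_num)).continuousAt
  refine hf.continuousAt.prodMk (h1.continuousAt.prodMk ?_)
  refine IsInducing.subtypeVal.continuousAt_iff.2 ?_
  exact (h2.add ((ContinuousLinearMap.flipₗᵢ ℝ E E ℝ).continuous.continuousAt.comp h2)).const_smul
    (2⁻¹ : ℝ)

variable [FiniteDimensional ℝ E]

theorem coordJet_comp {ψ : E → E} (hf : ContDiffAt ℝ 2 f (ψ y)) (hψ : ContDiffAt ℝ 2 ψ y) :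
    coordJet (f ∘ ψ) y = jetChange ψ y (coordJet f (ψ y)) := by
  refine Prod.ext rfl (Prod.ext ?_ (Subtype.ext ?_))
  · exact fderiv_comp y (hf.differentiableAt (by simp)) (hψ.differentiableAt (by simp))
  · ext v w
    have hsymm : IsSymmSndFDerivAt ℝ f (ψ y) := hf.isSymmSndFDerivAt (by simp)
    rw [jetChange, jetPull_form_apply]
    simp only [coordJet, SymForm.coe_symm_apply, fderiv_fderiv_comp_apply hf hψ,
      hsymm.eq (fderiv ℝ ψ y w)]
    ring

end CoordJet

section QuadraticForm

variable {E : Type*} [NormedAddCommGroup E] [NormedSpace ℝ E]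

theorem continuous_clm_apply_self :
    Continuous fun p : (E →L[ℝ] E →L[ℝ] ℝ) × E => p.1 p.2 p.2 :=
  (continuous_fst.clm_apply continuous_snd).clm_apply continuous_snd

theorem apply_self_lt_of_forall_norm_eq_one {A B : E →L[ℝ] E →L[ℝ] ℝ}
    (h : ∀ v, ‖v‖ = 1 → A v v < B v v) {v : E} (hv : v ≠ 0) : A v v < B v v := by
  have hunit := h (‖v‖⁻¹ • v) (by simp [norm_smul, hv])
  simp only [map_smul, smul_apply, smul_eq_mul] at hunit
  have hinv : 0 < ‖v‖⁻¹ := by positivity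
  exact lt_of_mul_lt_mul_left (lt_of_mul_lt_mul_left hunit hinv.le) hinv.le

/-- The nonnegative symmetric forms that are positive transversally to `W`, in the sense that all
their null vectors lie in `W`. -/
def SymForm.transversallyPositive (W : Submodule ℝ E) : Set (SymForm E) :=
  {P | (∀ v, 0 ≤ P.1 v v) ∧ ∀ v, P.1 v v = 0 → v ∈ W}

variable {W : Submodule ℝ E}

theorem SymForm.transversallyPositive_mono {W' : Submodule ℝ E} (h : W ≤ W') :
    transversallyPositive W ⊆ transversallyPositive W' :=
  fun _ hP => ⟨hP.1, fun v hv => h (hP.2 v hv)⟩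

theorem SymForm.convex_transversallyPositive : Convex ℝ (transversallyPositive W) := by
  refine convex_iff_forall_pos.2 ?_
  rintro P ⟨hP, hPW⟩ Q ⟨hQ, -⟩ a b ha hb -
  have haP (v : E) : 0 ≤ a * P.1 v v := mul_nonneg ha.le (hP v)
  have hbQ (v : E) : 0 ≤ b * Q.1 v v := mul_nonneg hb.le (hQ v)
  refine ⟨fun v => add_nonneg (haP v) (hbQ v), fun v hv => hPW v ?_⟩
  have hsum : a * P.1 v v + b * Q.1 v v = 0 := hv
  exact (mul_eq_zero.1 ((add_eq_zero_iff_of_nonneg (haP v) (hbQ v)).1 hsum).1).resolve_left ha.ne'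

variable [FiniteDimensional ℝ E]

theorem eventually_forall_ne_zero_apply_self_lt {A B : E →L[ℝ] E →L[ℝ] ℝ}
    (h : ∀ v ≠ 0, A v v < B v v) : ∀ᶠ B' in 𝓝 B, ∀ v ≠ 0, A v v < B' v v := by
  have hA : Continuous fun v => A v v :=
    continuous_clm_apply_self.comp (Continuous.prodMk_right A)
  have hsphere : ∀ᶠ B' in 𝓝 B, ∀ v ∈ Metric.sphere (0 : E) 1, A v v < B' v v :=
    (isCompact_sphere (0 : E) 1).eventually_forall_of_forall_eventually fun v hv =>
      (hA.comp continuous_snd).continuousAt.eventually_lt continuous_clm_apply_self.continuousAt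
        (h v (Metric.ne_of_mem_sphere hv one_ne_zero))
  filter_upwards [hsphere] with B' hB' v hv
  exact apply_self_lt_of_forall_norm_eq_one (fun w hw => hB' w (mem_sphere_zero_iff_norm.2 hw)) hv

/- This is Finsler's lemma. On the compact unit sphere, either `P v v > 0`, and this persists after
subtracting a small multiple of `A`, or `v ∈ W` and subtracting `A` helps. -/
theorem exists_pos_forall_ne_zero_smul_apply_self_lt {A P : E →L[ℝ] E →L[ℝ] ℝ}
    (hA : ∀ w ∈ W, w ≠ 0 → A w w < 0) (hP : ∀ v, 0 ≤ P v v) (hPW : ∀ v, P v v = 0 → v ∈ W) :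
    ∃ t : ℝ, 0 < t ∧ ∀ v ≠ 0, (t • A) v v < P v v := by
  have hcont (B : E →L[ℝ] E →L[ℝ] ℝ) : Continuous fun p : ℝ × E => B p.2 p.2 :=
    continuous_clm_apply_self.comp (continuous_const.prodMk continuous_snd)
  have hlocal : ∀ v ∈ Metric.sphere (0 : E) 1,
      ∀ᶠ p : ℝ × E in 𝓝 (0, v), 0 < p.1 → p.1 * A p.2 p.2 < P p.2 p.2 := by
    intro v hv
    rcases (hP v).eq_or_lt with hPv | hPv
    · have hAv : A v v < 0 := hA v (hPW v hPv.symm) (Metric.ne_of_mem_sphere hv one_ne_zero)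
      filter_upwards [(hcont A).continuousAt.eventually_lt_const hAv] with p hp ht
      exact (mul_neg_of_pos_of_neg ht hp).trans_le (hP p.2)
    · have h0 : (0 : ℝ) * A v v < P v v := by rwa [zero_mul]
      filter_upwards [(continuous_fst.mul (hcont A)).continuousAt.eventually_lt
        (hcont P).continuousAt h0] with p hp _ using hp
  have hsphere : ∀ᶠ t : ℝ in 𝓝 0, ∀ v ∈ Metric.sphere (0 : E) 1, 0 < t → t * A v v < P v v :=
    (isCompact_sphere (0 : E) 1).eventually_forall_of_forall_eventually
      (P := fun t v => 0 < t → t * A v v < P v v) hlocal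
  obtain ⟨t, ht, ht0⟩ := ((hsphere.filter_mono nhdsWithin_le_nhds).and
    (self_mem_nhdsWithin : ∀ᶠ t : ℝ in 𝓝[>] 0, 0 < t)).exists
  exact ⟨t, ht0, fun v hv => apply_self_lt_of_forall_norm_eq_one
    (fun w hw => ht w (mem_sphere_zero_iff_norm.2 hw) ht0) hv⟩

theorem SymForm.transversallyPositive_subset_interior {S : Set (SymForm E)}
    (hadd : ∀ A ∈ S, ∀ P : SymForm E, (∀ v, 0 ≤ P.1 v v) → A + P ∈ S)
    (hsmul : ∀ A ∈ S, ∀ t : ℝ, 0 < t → t • A ∈ S) (hW : IsTotallyFreeSubspace S W) :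
    transversallyPositive W ⊆ interior S := by
  rintro P ⟨hP, hPW⟩
  obtain ⟨A, hAS, hA⟩ := hW
  obtain ⟨t, ht, htA⟩ := exists_pos_forall_ne_zero_smul_apply_self_lt hA hP hPW
  rw [mem_interior_iff_mem_nhds]
  filter_upwards [continuous_subtype_val.continuousAt.eventually
    (eventually_forall_ne_zero_apply_self_lt htA)] with B hB
  have hnonneg (v : E) : 0 ≤ (B - t • A).1 v v := by
    rcases eq_or_ne v 0 with rfl | hv
    · simp
    · exact sub_nonneg.2 (hB v hv).le
  have hmem := hadd _ (hsmul A hAS t ht) (B - t • A) hnonneg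
  rwa [add_sub_cancel] at hmem

end QuadraticForm

section JetAt

variable {E : Type*} [NormedAddCommGroup E] [NormedSpace ℝ E]
  {Z : Type*} [TopologicalSpace Z] [ChartedSpace E Z]

theorem mfderiv_eq_fderiv_comp_chart_symm {G : Type*} [NormedAddCommGroup G] [NormedSpace ℝ G]
    {f : Z → G} {z : Z} (hf : MDifferentiableAt 𝓘(ℝ, E) 𝓘(ℝ, G) f z) :
    mfderiv 𝓘(ℝ, E) 𝓘(ℝ, G) f z = fderiv ℝ (f ∘ (chartAt E z).symm) (chartAt E z z) := by
  rw [hf.mfderiv]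
  simp only [mfld_simps, fderivWithin_univ]
  rfl

variable [IsManifold 𝓘(ℝ, E) ∞ Z]

theorem contDiffAt_comp_chart_symm {G : Type*} [NormedAddCommGroup G] [NormedSpace ℝ G]
    {f : Z → G} {z z₀ : Z} (hf : ContMDiffAt 𝓘(ℝ, E) 𝓘(ℝ, G) 2 f z)
    (hz : z ∈ (chartAt E z₀).source) :
    ContDiffAt ℝ 2 (f ∘ (chartAt E z₀).symm) (chartAt E z₀ z) := by
  have hsymm : ContMDiffAt 𝓘(ℝ, E) 𝓘(ℝ, E) 2 (chartAt E z₀).symm (chartAt E z₀ z) :=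
    (contMDiffOn_chart_symm (n := ∞)).contMDiffAt
      ((chartAt E z₀).open_target.mem_nhds ((chartAt E z₀).map_source hz))
      |>.of_le ENat.LEInfty.out
  rw [← (chartAt E z₀).left_inv hz] at hf
  exact (hf.comp _ hsymm).contDiffAt

variable [FiniteDimensional ℝ E] {f g : Z → ℝ} {z : Z}

theorem isLinearMap_symJet (z : Z) : IsLinearMap ℝ (symJet E z) where
  map_add A B := by
    refine Prod.ext ?_ (Prod.ext ?_ rfl)
    · exact (add_zero (0 : ℝ)).symm
    · exact (add_zero (0 : E →L[ℝ] ℝ)).symm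
  map_smul t A := by
    refine Prod.ext ?_ (Prod.ext ?_ rfl)
    · exact (smul_zero t (A := ℝ)).symm
    · exact (smul_zero t (A := E →L[ℝ] ℝ)).symm

theorem jetAt_congr (h : f =ᶠ[𝓝 z] g) : jetAt E f z = jetAt E g z := by
  have hsymm := (chartAt E z).continuousAt_symm (mem_chart_target E z)
  rw [ContinuousAt, (chartAt E z).left_inv (mem_chart_source E z)] at hsymm
  exact coordJet_congr (hsymm.eventually h)

theorem eq_zero_of_jetAt_eq_symJet {A : SymForm E} (h : jetAt E g z = symJet E z A) :
    g z = 0 := by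
  have h0 : g ((chartAt E z).symm (chartAt E z z)) = 0 := congrArg Prod.fst h
  rwa [(chartAt E z).left_inv (mem_chart_source E z)] at h0

theorem jetAt_zero : jetAt E (0 : Z → ℝ) z = 0 :=
  coordJet_zero

theorem jetAt_add (hf : ContMDiffAt 𝓘(ℝ, E) 𝓘(ℝ, ℝ) 2 f z)
    (hg : ContMDiffAt 𝓘(ℝ, E) 𝓘(ℝ, ℝ) 2 g z) :
    jetAt E (f + g) z = jetAt E f z + jetAt E g z :=
  coordJet_add (contDiffAt_comp_chart_symm hf (mem_chart_source E z))
    (contDiffAt_comp_chart_symm hg (mem_chart_source E z))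

theorem jetAt_sum {ι : Type*} (s : Finset ι) {f : ι → Z → ℝ}
    (hf : ∀ j ∈ s, ContMDiffAt 𝓘(ℝ, E) 𝓘(ℝ, ℝ) 2 (f j) z) :
    jetAt E (∑ j ∈ s, f j) z = ∑ j ∈ s, jetAt E (f j) z := by
  classical
  induction s using Finset.induction_on with
  | empty => simpa using jetAt_zero
  | insert a s ha ih =>
    have hs : ∀ j ∈ s, ContMDiffAt 𝓘(ℝ, E) 𝓘(ℝ, ℝ) 2 (f j) z := fun j hj => hf j (by simp [hj])
    have hsum : ContMDiffAt 𝓘(ℝ, E) 𝓘(ℝ, ℝ) 2 (∑ j ∈ s, f j) z := by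
      simpa only [Finset.sum_fn] using contMDiffAt_finsetSum hs
    rw [Finset.sum_insert ha, jetAt_add (hf a (by simp)) hsum, ih hs, Finset.sum_insert ha]

theorem jetAt_mul_of_critical (hf : ContMDiffAt 𝓘(ℝ, E) 𝓘(ℝ, ℝ) 2 f z)
    (hg : ContMDiffAt 𝓘(ℝ, E) 𝓘(ℝ, ℝ) 2 g z) {P : SymForm E} (h : jetAt E g z = symJet E z P) :
    jetAt E (f * g) z = f z • jetAt E g z := by
  have h' : coordJet (g ∘ (chartAt E z).symm) (chartAt E z z) = (0, 0, P) := h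
  have key := coordJet_mul_of_critical (contDiffAt_comp_chart_symm hf (mem_chart_source E z))
    (contDiffAt_comp_chart_symm hg (mem_chart_source E z))
    (congrArg Prod.fst h') (congrArg (fun J => J.2.1) h')
  rwa [Function.comp_apply, (chartAt E z).left_inv (mem_chart_source E z)] at key

theorem jetAt_norm_sq_mem {G : Type*} [NormedAddCommGroup G] [InnerProductSpace ℝ G]
    {N : Z → G} (hN : ContMDiffAt 𝓘(ℝ, E) 𝓘(ℝ, G) 2 N z) (h0 : N z = 0) :
    jetAt E (fun y => ‖N y‖ ^ 2) z ∈ symJet E z '' SymForm.transversallyPositive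
      (LinearMap.ker (mfderiv 𝓘(ℝ, E) 𝓘(ℝ, G) N z).toLinearMap) := by
  have h0' : (N ∘ (chartAt E z).symm) (chartAt E z z) = 0 := by
    rwa [Function.comp_apply, (chartAt E z).left_inv (mem_chart_source E z)]
  obtain ⟨P, hJ, hP⟩ :=
    exists_coordJet_norm_sq (contDiffAt_comp_chart_symm hN (mem_chart_source E z)) h0'
  refine ⟨P, ⟨fun v => ?_, fun v hv => ?_⟩, hJ.symm⟩
  · rw [hP]
    positivity
  · rw [mfderiv_eq_fderiv_comp_chart_symm (hN.mdifferentiableAt (by simp))]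
    have hv' : fderiv ℝ (N ∘ (chartAt E z).symm) (chartAt E z z) v = 0 := by simpa [hP] using hv
    exact hv'

theorem coordChange_jetAt {z₀ : Z} (hf : ContMDiffAt 𝓘(ℝ, E) 𝓘(ℝ, ℝ) 2 f z)
    (hz : z ∈ (chartAt E z₀).source) :
    (jetBundleCore E Z).coordChange (achart E z) (achart E z₀) z (jetAt E f z) =
      coordJet (f ∘ (chartAt E z₀).symm) (chartAt E z₀ z) := by
  have hψ := contDiffAt_transition E Z (achart E z) (achart E z₀) (mem_chart_source E z) hz
  have hψz : ((chartAt E z) ∘ (chartAt E z₀).symm) (chartAt E z₀ z) = chartAt E z z := by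
    simp [(chartAt E z₀).left_inv hz]
  have hf' := contDiffAt_comp_chart_symm hf (mem_chart_source E z)
  rw [← hψz] at hf'
  have key := coordJet_comp hf' hψ
  rw [hψz] at key
  refine key.symm.trans (coordJet_congr ?_)
  have hsource : ∀ᶠ y in 𝓝 (chartAt E z₀ z), (chartAt E z₀).symm y ∈ (chartAt E z).source := by
    refine ((chartAt E z₀).continuousAt_symm ((chartAt E z₀).map_source hz)).eventually
      ((chartAt E z).open_source.mem_nhds ?_)
    rw [(chartAt E z₀).left_inv hz]
    exact mem_chart_source E z
  filter_upwards [hsource] with y hy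
  exact congrArg f ((chartAt E z).left_inv hy)

theorem continuous_jetAt (hf : ContMDiff 𝓘(ℝ, E) 𝓘(ℝ, ℝ) 2 f) :
    Continuous fun z : Z => (⟨z, jetAt E f z⟩ : JetBundle E Z) := by
  refine continuous_iff_continuousAt.2 fun z₀ => ?_
  refine (FiberBundle.continuousAt_totalSpace (JetModel E)
    (E := (jetBundleCore E Z).Fiber) _).2 ⟨continuousAt_id, ?_⟩
  have hz₀ := mem_chart_source E z₀
  have hcoord : ContinuousAt
      (fun z => coordJet (f ∘ (chartAt E z₀).symm) (chartAt E z₀ z)) z₀ :=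
    (continuousAt_coordJet (contDiffAt_comp_chart_symm (hf z₀) hz₀)).comp
      ((chartAt E z₀).continuousAt hz₀)
  refine hcoord.congr ?_
  filter_upwards [(chartAt E z₀).open_source.mem_nhds hz₀] with z hz
  exact (coordChange_jetAt (hf z) hz).symm

theorem exists_isStrictlySubharmonicOn {F : Set (JetBundle E Z)} {s : Set Z}
    (hf : ContMDiff 𝓘(ℝ, E) 𝓘(ℝ, ℝ) 2 f)
    (hs : ∀ z ∈ s, (⟨z, jetAt E f z⟩ : JetBundle E Z) ∈ interior F) :
    ∃ U : Set Z, IsOpen U ∧ s ⊆ U ∧ IsStrictlySubharmonicOn E F f U :=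
  ⟨_, isOpen_interior.preimage (continuous_jetAt hf), hs, hf.contMDiffOn, fun _ hz => hz⟩

end JetAt

section ConeBundle

variable {B : Type*} [TopologicalSpace B] {F : Type*} [NormedAddCommGroup F] [NormedSpace ℝ F]
  {V : B → Type*} [∀ b, AddCommGroup (V b)] [∀ b, Module ℝ (V b)] [∀ b, TopologicalSpace (V b)]
  [TopologicalSpace (TotalSpace F V)] [FiberBundle F V] [VectorBundle ℝ F V]

theorem continuousAt_totalSpace_smul {Y : Type*} [TopologicalSpace Y] {b : Y → B} {c : Y → ℝ}
    {s : ∀ y, V (b y)} {y₀ : Y} (hc : ContinuousAt c y₀)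
    (hs : ContinuousAt (fun y => (⟨b y, s y⟩ : TotalSpace F V)) y₀) :
    ContinuousAt (fun y => (⟨b y, c y • s y⟩ : TotalSpace F V)) y₀ := by
  rw [FiberBundle.continuousAt_totalSpace] at hs ⊢
  refine ⟨hs.1, (hc.smul hs.2).congr ?_⟩
  filter_upwards [hs.1 ((trivializationAt F V (b y₀)).open_baseSet.mem_nhds
    (mem_baseSet_trivializationAt F V (b y₀)))] with y hy
  exact (((trivializationAt F V (b y₀)).linear ℝ hy).map_smul _ _).symm

theorem continuousAt_totalSpace_add {Y : Type*} [TopologicalSpace Y] {b : Y → B}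
    {s t : ∀ y, V (b y)} {y₀ : Y}
    (hs : ContinuousAt (fun y => (⟨b y, s y⟩ : TotalSpace F V)) y₀)
    (ht : ContinuousAt (fun y => (⟨b y, t y⟩ : TotalSpace F V)) y₀) :
    ContinuousAt (fun y => (⟨b y, s y + t y⟩ : TotalSpace F V)) y₀ := by
  rw [FiberBundle.continuousAt_totalSpace] at hs ht ⊢
  refine ⟨hs.1, (hs.2.add ht.2).congr ?_⟩
  filter_upwards [hs.1 ((trivializationAt F V (b y₀)).open_baseSet.mem_nhds
    (mem_baseSet_trivializationAt F V (b y₀)))] with y hy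
  exact (((trivializationAt F V (b y₀)).linear ℝ hy).map_add _ _).symm

variable {K : Set (TotalSpace F V)}

theorem smul_mem_interior_of_cone
    (hK : ∀ b, ∀ v : V b, (⟨b, v⟩ : TotalSpace F V) ∈ K → ∀ t : ℝ, 0 < t → ⟨b, t • v⟩ ∈ K)
    {b : B} {v : V b} (hv : (⟨b, v⟩ : TotalSpace F V) ∈ interior K) {t : ℝ} (ht : 0 < t) :
    (⟨b, t • v⟩ : TotalSpace F V) ∈ interior K := by
  have hcont : Continuous fun p : TotalSpace F V => (⟨p.1, t⁻¹ • p.2⟩ : TotalSpace F V) :=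
    continuous_iff_continuousAt.2 fun p => continuousAt_totalSpace_smul continuousAt_const
      (continuousAt_id : ContinuousAt (fun p : TotalSpace F V => p) p)
  refine mem_interior.2 ⟨_, ?_, (isOpen_interior (s := K)).preimage hcont, ?_⟩
  · rintro ⟨y, w⟩ hw
    simpa [smul_smul, ht.ne'] using hK y _ (interior_subset hw) t ht
  · simpa [smul_smul, ht.ne'] using hv

/- Dividing by `a > 0`, the section `σ + a • τ` becomes `a⁻¹ • σ + τ`, which is close to `τ`. -/
theorem eventually_add_smul_mem_interior_of_cone
    (hK : ∀ b, ∀ v : V b, (⟨b, v⟩ : TotalSpace F V) ∈ K → ∀ t : ℝ, 0 < t → ⟨b, t • v⟩ ∈ K)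
    {σ τ : ∀ b, V b} {b : B} (hσ : ContinuousAt (fun y => (⟨y, σ y⟩ : TotalSpace F V)) b)
    (hτ : ContinuousAt (fun y => (⟨y, τ y⟩ : TotalSpace F V)) b)
    (hb : (⟨b, τ b⟩ : TotalSpace F V) ∈ interior K) :
    ∀ᶠ p : ℝ × B in Filter.atTop ×ˢ 𝓝 b,
      (⟨p.2, σ p.2 + p.1 • τ p.2⟩ : TotalSpace F V) ∈ interior K := by
  have hσ' : ContinuousAt (fun q : ℝ × B => (⟨q.2, σ q.2⟩ : TotalSpace F V)) (0, b) :=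
    ContinuousAt.comp (g := fun y => (⟨y, σ y⟩ : TotalSpace F V)) (x := ((0 : ℝ), b)) hσ
      continuousAt_snd
  have hτ' : ContinuousAt (fun q : ℝ × B => (⟨q.2, τ q.2⟩ : TotalSpace F V)) (0, b) :=
    ContinuousAt.comp (g := fun y => (⟨y, τ y⟩ : TotalSpace F V)) (x := ((0 : ℝ), b)) hτ
      continuousAt_snd
  have hcont := continuousAt_totalSpace_add (continuousAt_totalSpace_smul continuousAt_fst hσ') hτ'
  have hnear : ∀ᶠ q : ℝ × B in 𝓝 0 ×ˢ 𝓝 b,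
      (⟨q.2, q.1 • σ q.2 + τ q.2⟩ : TotalSpace F V) ∈ interior K := by
    rw [← nhds_prod_eq]
    exact hcont.eventually (isOpen_interior.mem_nhds (by simpa using hb))
  filter_upwards [(tendsto_inv_atTop_zero.prodMap Filter.tendsto_id).eventually hnear,
    (Filter.eventually_gt_atTop (0 : ℝ)).prod_inl (𝓝 b)] with p hp hp0
  simpa [smul_smul, hp0.ne'] using smul_mem_interior_of_cone hK hp hp0

end ConeBundle

section ConeBundleManifold

variable {E : Type*} [NormedAddCommGroup E] [NormedSpace ℝ E] [FiniteDimensional ℝ E]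
  {Z : Type*} [TopologicalSpace Z] [T2Space Z] [SigmaCompactSpace Z]
  [ChartedSpace E Z] [IsManifold 𝓘(ℝ, E) ∞ Z]
  {F : Type*} [NormedAddCommGroup F] [NormedSpace ℝ F]
  {V : Z → Type*} [∀ z, AddCommGroup (V z)] [∀ z, Module ℝ (V z)] [∀ z, TopologicalSpace (V z)]
  [TopologicalSpace (TotalSpace F V)] [FiberBundle F V] [VectorBundle ℝ F V]

theorem exists_contMDiffMap_add_smul_mem_interior_of_cone (n : ℕ∞) {K : Set (TotalSpace F V)}
    (hK : ∀ z, ∀ v : V z, (⟨z, v⟩ : TotalSpace F V) ∈ K → ∀ t : ℝ, 0 < t → ⟨z, t • v⟩ ∈ K)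
    {s : Set Z} (hs : IsClosed s) {σ τ : ∀ z, V z}
    (hσ : Continuous fun z => (⟨z, σ z⟩ : TotalSpace F V))
    (hτ : Continuous fun z => (⟨z, τ z⟩ : TotalSpace F V))
    (hτK : ∀ z ∈ s, (⟨z, τ z⟩ : TotalSpace F V) ∈ interior K) :
    ∃ l : C^n⟮𝓘(ℝ, E), Z; 𝓘(ℝ, ℝ), ℝ⟯,
      ∀ z ∈ s, (⟨z, σ z + l z • τ z⟩ : TotalSpace F V) ∈ interior K := by
  let t : Z → Set ℝ := fun z =>
    {a | z ∈ s → ∀ c ≥ a, (⟨z, σ z + c • τ z⟩ : TotalSpace F V) ∈ interior K}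
  have hconvex (z : Z) : Convex ℝ (t z) := by
    have hupper : IsUpperSet (t z) := fun a c hac ha hz d hd => ha hz d (hac.trans hd)
    exact hupper.ordConnected.convex
  have hloc (z : Z) : ∃ a : ℝ, ∀ᶠ y in 𝓝 z, a ∈ t y := by
    by_cases hz : z ∈ s
    · obtain ⟨p, hp, q, hq, hpq⟩ := Filter.eventually_prod_iff.1 <|
        eventually_add_smul_mem_interior_of_cone hK hσ.continuousAt hτ.continuousAt (hτK z hz)
      obtain ⟨a, ha⟩ := Filter.eventually_atTop.1 hp
      exact ⟨a, hq.mono fun y hy _ c hc => hpq (ha c hc) hy⟩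
    · refine ⟨0, ?_⟩
      filter_upwards [hs.isOpen_compl.mem_nhds hz] with y hy hys using absurd hys hy
  obtain ⟨l, hl⟩ := exists_contMDiffMap_forall_mem_convex_of_local_const (n := n) 𝓘(ℝ, E)
    hconvex hloc
  exact ⟨l, fun z hz => hl z hz _ le_rfl⟩

end ConeBundleManifold

section SliceChart

variable {E : Type*} [NormedAddCommGroup E] [NormedSpace ℝ E]
  {Z : Type*} [TopologicalSpace Z] [ChartedSpace E Z]
  {E' : Type*} [NormedAddCommGroup E'] [NormedSpace ℝ E']
  {X : Type*} [TopologicalSpace X] [ChartedSpace E' X] {n : WithTop ℕ∞} {i : X → Z}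

variable (E) in
/-- `C^n` slice coordinates `q` on the open set `W`, with inverse `s`: they take values in
`E' × C`, the points of `i '' X` in `W` have second coordinate zero, and `ρ` is the retraction onto
`X` that forgets the second coordinate. The maps are total, and only their values on `W`,
respectively near `q '' W`, matter. -/
structure IsSliceChart {C : Type*} [NormedAddCommGroup C] [NormedSpace ℝ C] (n : WithTop ℕ∞)
    (i : X → Z) (W : Set Z) (q : Z → E' × C) (s : E' × C → Z) (ρ : Z → X) : Prop where
  isOpen : IsOpen W
  contMDiffOn : ContMDiffOn 𝓘(ℝ, E) 𝓘(ℝ, E' × C) n q W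
  contMDiffAt_symm : ∀ z ∈ W, ContMDiffAt 𝓘(ℝ, E' × C) 𝓘(ℝ, E) n s (q z)
  contMDiffOn_retraction : ContMDiffOn 𝓘(ℝ, E) 𝓘(ℝ, E') n ρ W
  left_inv : ∀ z ∈ W, s (q z) = z
  apply_retraction : ∀ z ∈ W, i (ρ z) = s ((q z).1, 0)
  retraction_apply : ∀ x, i x ∈ W → ρ (i x) = x
  snd_apply : ∀ x, i x ∈ W → (q (i x)).2 = 0

/- Near `i x` the identity is `s ∘ q` and the retraction `i ∘ ρ` is `s ∘ L ∘ q`, so both maps have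
the same derivative in the direction of a vector killed by the second component of `q`. -/
theorem IsSliceChart.ker_mfderiv_snd_le_range {C : Type*} [NormedAddCommGroup C] [NormedSpace ℝ C]
    {W : Set Z} {q : Z → E' × C} {s : E' × C → Z} {ρ : Z → X} (h : IsSliceChart E n i W q s ρ)
    (hn : n ≠ 0) {x : X} (hx : i x ∈ W) (hi : MDifferentiableAt 𝓘(ℝ, E') 𝓘(ℝ, E) i x) :
    LinearMap.ker (mfderiv 𝓘(ℝ, E) 𝓘(ℝ, C) (fun z => (q z).2) (i x)).toLinearMap ≤
      LinearMap.range (mfderiv 𝓘(ℝ, E') 𝓘(ℝ, E) i x).toLinearMap := by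
  intro v hv
  have hW := h.isOpen.mem_nhds hx
  have hq := (h.contMDiffOn.contMDiffAt hW).mdifferentiableAt hn
  have hs := (h.contMDiffAt_symm _ hx).mdifferentiableAt hn
  have hρ := (h.contMDiffOn_retraction.contMDiffAt hW).mdifferentiableAt hn
  let L : E' × C →L[ℝ] E' × C := (ContinuousLinearMap.fst ℝ E' C).prod 0
  have hLx : L (q (i x)) = q (i x) := Prod.ext rfl (h.snd_apply x hx).symm
  have hLv : L (mfderiv 𝓘(ℝ, E) 𝓘(ℝ, E' × C) q (i x) v) =
      mfderiv 𝓘(ℝ, E) 𝓘(ℝ, E' × C) q (i x) v := by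
    refine Prod.ext rfl (Eq.symm (.trans ?_ hv))
    have hsnd := (ContinuousLinearMap.snd ℝ E' C).mdifferentiableAt (x := q (i x))
    exact (mfderiv_comp_apply (i x) hsnd hq v).symm ▸ by rw [ContinuousLinearMap.mfderiv_eq]; rfl
  have hid : s ∘ q =ᶠ[𝓝 (i x)] id := Filter.eventually_of_mem hW h.left_inv
  have hretraction : i ∘ ρ =ᶠ[𝓝 (i x)] s ∘ (L ∘ q) :=
    Filter.eventually_of_mem hW h.apply_retraction
  have hsq : mfderiv 𝓘(ℝ, E' × C) 𝓘(ℝ, E) s (q (i x))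
      (mfderiv 𝓘(ℝ, E) 𝓘(ℝ, E' × C) q (i x) v) = v := by
    rw [← mfderiv_comp_apply (i x) hs hq, hid.mfderiv_eq, mfderiv_id]
    rfl
  have hsLq : mfderiv 𝓘(ℝ, E) 𝓘(ℝ, E) (s ∘ (L ∘ q)) (i x) v =
      mfderiv 𝓘(ℝ, E' × C) 𝓘(ℝ, E) s (q (i x))
        (L (mfderiv 𝓘(ℝ, E) 𝓘(ℝ, E' × C) q (i x) v)) := by
    rw [mfderiv_comp_apply_of_eq (i x) hs (L.mdifferentiableAt.comp (i x) hq) hLx,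
      mfderiv_comp_apply (i x) L.mdifferentiableAt hq, L.mfderiv_eq]
    rfl
  rw [hLv, hsq] at hsLq
  exact ⟨mfderiv 𝓘(ℝ, E) 𝓘(ℝ, E') ρ (i x) v,
    (mfderiv_comp_apply_of_eq (i x) hi hρ (h.retraction_apply x hx) v).symm.trans
      ((DFunLike.congr_fun hretraction.mfderiv_eq v).trans hsLq)⟩

variable [FiniteDimensional ℝ E]

theorem exists_euclidean_slice {x₀ : X} (h : IsImmersionAt 𝓘(ℝ, E') 𝓘(ℝ, E) n i x₀) :
    ∃ (k : ℕ) (e : E ≃L[ℝ] E' × EuclideanSpace ℝ (Fin k)),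
      ∀ x ∈ h.domChart.source, e (h.codChart (i x)) = (h.domChart x, 0) := by
  have : FiniteDimensional ℝ (E' × h.complement) := h.equiv.symm.toLinearEquiv.finiteDimensional
  have : FiniteDimensional ℝ h.complement :=
    FiniteDimensional.of_surjective (LinearMap.snd ℝ E' h.complement) LinearMap.snd_surjective
  refine ⟨_, h.equiv.symm.trans ((ContinuousLinearEquiv.refl ℝ E').prodCongr toEuclidean),
    fun x hx => ?_⟩
  have hxt : h.domChart x ∈ (h.domChart.extend 𝓘(ℝ, E')).target := by
    simpa using h.domChart.map_source hx
  have hwritten := h.writtenInCharts hxt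
  simp only [Function.comp_apply, OpenPartialHomeomorph.extend_coe,
    OpenPartialHomeomorph.extend_coe_symm, modelWithCornersSelf_coe,
    modelWithCornersSelf_coe_symm, id_eq, h.domChart.left_inv hx] at hwritten
  simp [hwritten]

theorem exists_isSliceChart (hi : IsSmoothEmbedding 𝓘(ℝ, E') 𝓘(ℝ, E) n i) (x₀ : X) :
    ∃ (k : ℕ) (W : Set Z) (q : Z → E' × EuclideanSpace ℝ (Fin k))
      (s : E' × EuclideanSpace ℝ (Fin k) → Z) (ρ : Z → X),
      i x₀ ∈ W ∧ IsSliceChart E n i W q s ρ := by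
  have h := hi.isImmersion.isImmersionAt x₀
  obtain ⟨k, e, he⟩ := exists_euclidean_slice h
  set φ := h.codChart
  set ψ := h.domChart
  have hiφ : ∀ x ∈ ψ.source, i x ∈ φ.source := h.source_subset_preimage_source
  let q : Z → E' × EuclideanSpace ℝ (Fin k) := fun z => e (φ z)
  have hq : ContMDiffOn 𝓘(ℝ, E) 𝓘(ℝ, E' × EuclideanSpace ℝ (Fin k)) n q φ.source :=
    e.contDiff.contMDiff.comp_contMDiffOn
      (contMDiffOn_of_mem_maximalAtlas h.codChart_mem_maximalAtlas)
  obtain ⟨V, hVopen, hV⟩ := hi.isEmbedding.isInducing.isOpen_iff.1 ψ.open_source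
  let W : Set Z := V ∩ (φ.source ∩ (fun z => (q z).1) ⁻¹' ψ.target)
  have hWψ {x : X} (hx : i x ∈ W) : x ∈ ψ.source := hV ▸ hx.1
  have hqW := hq.mono fun z (hz : z ∈ W) => hz.2.1
  refine ⟨k, W, q, fun p => φ.symm (e.symm p), fun z => ψ.symm (q z).1, ⟨?_, ?_, ?_⟩,
    ?_, hqW, fun z hz => ?_, ?_, fun z hz => ?_, fun z hz => ?_, fun x hx => ?_, fun x hx => ?_⟩
  · exact (hV ▸ h.mem_domChart_source : x₀ ∈ i ⁻¹' V)
  · exact h.mem_codChart_source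
  · simpa [q, he x₀ h.mem_domChart_source] using ψ.map_source h.mem_domChart_source
  · exact hVopen.inter ((continuous_fst.comp_continuousOn hq.continuousOn).isOpen_inter_preimage
      φ.open_source ψ.open_target)
  · refine ContMDiffAt.comp (I' := 𝓘(ℝ, E)) (g := φ.symm) (f := e.symm) _ ?_
      (e.symm.contDiff.contMDiff _)
    simpa [q] using (contMDiffOn_symm_of_mem_maximalAtlas h.codChart_mem_maximalAtlas).contMDiffAt
      (φ.open_target.mem_nhds (φ.map_source hz.2.1))
  · exact (contMDiffOn_symm_of_mem_maximalAtlas h.domChart_mem_maximalAtlas).comp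
      (contDiff_fst.contMDiff.comp_contMDiffOn hqW) fun z hz => hz.2.2
  · simp [q, φ.left_inv hz.2.1]
  · have hsource := ψ.map_target hz.2.2
    have hslice := he _ hsource
    rw [ψ.right_inv hz.2.2] at hslice
    simp only [← hslice, e.symm_apply_apply, φ.left_inv (hiφ _ hsource)]
  · simp [q, he x (hWψ hx), ψ.left_inv (hWψ hx)]
  · simp [q, he x (hWψ hx)]

end SliceChart

section Gluing

variable {E : Type*} [NormedAddCommGroup E] [NormedSpace ℝ E] [FiniteDimensional ℝ E]
  {Z : Type*} [TopologicalSpace Z] [T2Space Z] [SigmaCompactSpace Z]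
  [ChartedSpace E Z] [IsManifold 𝓘(ℝ, E) ∞ Z]

/- By `jetAt_mul_of_critical`, multiplying by the functions of a partition of unity and summing
only takes a convex combination of critical 2-jets. -/
theorem exists_contMDiff_jetAt_mem_symJet_image {s : Set Z} (hs : IsClosed s)
    {S : Z → Set (SymForm E)} (hS : ∀ z, Convex ℝ (S z))
    (hloc : ∀ z ∈ s, ∃ (W : Set Z) (g : Z → ℝ), IsOpen W ∧ z ∈ W ∧
      ContMDiffOn 𝓘(ℝ, E) 𝓘(ℝ, ℝ) 2 g W ∧ ∀ y ∈ W ∩ s, jetAt E g y ∈ symJet E y '' S y) :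
    ∃ g : Z → ℝ, ContMDiff 𝓘(ℝ, E) 𝓘(ℝ, ℝ) 2 g ∧
      ∀ z ∈ s, jetAt E g z ∈ symJet E z '' S z := by
  choose! W g hWopen hzW hg hgS using hloc
  obtain ⟨φ, hφ⟩ := SmoothPartitionOfUnity.exists_isSubordinate 𝓘(ℝ, E) hs
    (fun z : s => W z) (fun z => hWopen z z.2) (fun z hz => mem_iUnion.2 ⟨⟨z, hz⟩, hzW z hz⟩)
  refine ⟨fun y => ∑ᶠ j, φ j y • g j y,
    hφ.contMDiff_finsum_smul (fun z => hWopen z z.2) fun z => hg z z.2, fun z hz => ?_⟩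
  have hW : ∀ j ∈ φ.fintsupport z, z ∈ W j := fun j hj => hφ j ((φ.mem_fintsupport_iff z j).1 hj)
  have hgz : ∀ j ∈ φ.fintsupport z, ContMDiffAt 𝓘(ℝ, E) 𝓘(ℝ, ℝ) 2 (g j) z := fun j hj =>
    (hg j j.2).contMDiffAt ((hWopen j j.2).mem_nhds (hW j hj))
  have hφz (j : s) : ContMDiffAt 𝓘(ℝ, E) 𝓘(ℝ, ℝ) 2 (φ j) z :=
    (φ j).contMDiff.contMDiffAt.of_le ENat.LEInfty.out
  have hsum : (fun y => ∑ᶠ j, φ j y • g j y) =ᶠ[𝓝 z] ∑ j ∈ φ.fintsupport z, ⇑(φ j) * g j := by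
    filter_upwards [φ.eventually_finsupport_subset z] with y hy
    rw [Finset.sum_apply]
    refine finsum_eq_sum_of_support_subset _ fun j hj => hy ?_
    rw [φ.mem_finsupport]
    exact left_ne_zero_of_smul hj
  have hterm : ∀ j ∈ φ.fintsupport z, jetAt E (⇑(φ j) * g j) z = φ j z • jetAt E (g j) z := by
    intro j hj
    obtain ⟨P, -, hP⟩ := hgS j j.2 z ⟨hW j hj, hz⟩
    exact jetAt_mul_of_critical (hφz j) (hgz j hj) hP.symm
  rw [jetAt_congr hsum, jetAt_sum _ fun j hj => (hφz j).mul (hgz j hj), Finset.sum_congr rfl hterm]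
  exact ((hS z).is_linear_image (isLinearMap_symJet z)).sum_mem (fun j _ => φ.nonneg j z)
    (φ.sum_finsupport' z hz (φ.finsupport_subset_fintsupport z))
    fun j hj => hgS j j.2 z ⟨hW j hj, hz⟩

variable {E' : Type*} [NormedAddCommGroup E'] [NormedSpace ℝ E']
  {X : Type*} [TopologicalSpace X] [ChartedSpace E' X] {n : WithTop ℕ∞} {i : X → Z}

theorem exists_contMDiff_extension (m : ℕ∞) (hmn : m ≤ n)
    (hi : IsSmoothEmbedding 𝓘(ℝ, E') 𝓘(ℝ, E) n i) (hX : IsClosed (range i)) {u : X → ℝ}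
    (hu : ContMDiff 𝓘(ℝ, E') 𝓘(ℝ, ℝ) m u) :
    ∃ w : C^m⟮𝓘(ℝ, E), Z; 𝓘(ℝ, ℝ), ℝ⟯, ∀ x, w (i x) = u x := by
  let t : Z → Set ℝ := fun z => {c | ∀ x, i x = z → c = u x}
  have hconvex (z : Z) : Convex ℝ (t z) := by
    intro a ha b hb p q _ _ hpq x hx
    rw [ha x hx, hb x hx, ← add_smul, hpq, one_smul]
  have hloc (z : Z) : ∃ W ∈ 𝓝 z, ∃ w : Z → ℝ,
      ContMDiffOn 𝓘(ℝ, E) 𝓘(ℝ, ℝ) m w W ∧ ∀ y ∈ W, w y ∈ t y := by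
    by_cases hz : z ∈ range i
    · obtain ⟨x₀, rfl⟩ := hz
      obtain ⟨k, W, q, s, ρ, hxW, h⟩ := exists_isSliceChart hi x₀
      refine ⟨W, h.isOpen.mem_nhds hxW, u ∘ ρ,
        hu.comp_contMDiffOn (h.contMDiffOn_retraction.of_le hmn), ?_⟩
      rintro _ hy x rfl
      exact congrArg u (h.retraction_apply x hy)
    · exact ⟨(range i)ᶜ, hX.isOpen_compl.mem_nhds hz, fun _ => 0, contMDiffOn_const,
        fun y hy x hx => absurd ⟨x, hx⟩ hy⟩
  obtain ⟨w, hw⟩ := exists_contMDiffMap_forall_mem_convex_of_local 𝓘(ℝ, E) hconvex hloc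
  exact ⟨w, fun x => hw (i x) x rfl⟩

theorem exists_contMDiff_jetAt_mem_transversallyPositive (hn : 2 ≤ n)
    (hi : IsSmoothEmbedding 𝓘(ℝ, E') 𝓘(ℝ, E) n i) (hX : IsClosed (range i)) :
    ∃ g : Z → ℝ, ContMDiff 𝓘(ℝ, E) 𝓘(ℝ, ℝ) 2 g ∧
      ∀ x, jetAt E g (i x) ∈ symJet E (i x) '' SymForm.transversallyPositive (E := E)
        (LinearMap.range (mfderiv 𝓘(ℝ, E') 𝓘(ℝ, E) i x).toLinearMap) := by
  have hn0 : n ≠ 0 := (two_pos.trans_le hn).ne'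
  let S : Z → Set (SymForm E) := fun z => {P | ∀ x, i x = z → P ∈ SymForm.transversallyPositive
    (E := E) (LinearMap.range (mfderiv 𝓘(ℝ, E') 𝓘(ℝ, E) i x).toLinearMap)}
  have hS (z : Z) : Convex ℝ (S z) := fun P hP Q hQ a b ha hb hab x hx =>
    SymForm.convex_transversallyPositive (hP x hx) (hQ x hx) ha hb hab
  have hloc : ∀ z ∈ range i, ∃ (W : Set Z) (g : Z → ℝ), IsOpen W ∧ z ∈ W ∧
      ContMDiffOn 𝓘(ℝ, E) 𝓘(ℝ, ℝ) 2 g W ∧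
        ∀ y ∈ W ∩ range i, jetAt E g y ∈ symJet E y '' S y := by
    rintro _ ⟨x₀, rfl⟩
    obtain ⟨k, W, q, s, ρ, hxW, h⟩ := exists_isSliceChart hi x₀
    have hnormal : ContMDiffOn 𝓘(ℝ, E) 𝓘(ℝ, EuclideanSpace ℝ (Fin k)) 2 (fun z => (q z).2) W :=
      contDiff_snd.contMDiff.comp_contMDiffOn (h.contMDiffOn.of_le hn)
    refine ⟨W, fun z => ‖(q z).2‖ ^ 2, h.isOpen, hxW,
      (contDiff_norm_sq ℝ).contMDiff.comp_contMDiffOn hnormal, ?_⟩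
    rintro _ ⟨hxW, x, rfl⟩
    refine image_mono ?_ (jetAt_norm_sq_mem (hnormal.contMDiffAt (h.isOpen.mem_nhds hxW))
      (h.snd_apply x hxW))
    intro P hP x' hx'
    obtain rfl := hi.isEmbedding.injective hx'
    exact SymForm.transversallyPositive_mono (E := E) (h.ker_mfderiv_snd_le_range hn0 hxW
      (hi.contMDiff.mdifferentiable hn0 _)) hP
  obtain ⟨g, hg, hgS⟩ := exists_contMDiff_jetAt_mem_symJet_image hX hS hloc
  refine ⟨g, hg, fun x => image_mono ?_ (hgS (i x) ⟨x, rfl⟩)⟩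
  exact fun P hP => hP x rfl

end Gluing

section Subequation

variable {E : Type*} [NormedAddCommGroup E] [NormedSpace ℝ E] [FiniteDimensional ℝ E]
  {Z : Type*} [TopologicalSpace Z] [ChartedSpace E Z] [IsManifold 𝓘(ℝ, E) ∞ Z]
  {F : Set (JetBundle E Z)}

theorem transversallyPositive_subset_interior_symSlice
    (hF : ∀ z, ∀ J ∈ jetSlice E F z, ∀ P : SymForm E,
      (∀ v, 0 ≤ P.1 v v) → J + symJet E z P ∈ jetSlice E F z)
    (hcone : HasConeProperty E F) {z : Z} {W : Submodule ℝ E}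
    (hW : IsTotallyFreeSubspace (symSlice E F z) W) :
    SymForm.transversallyPositive W ⊆ interior (symSlice E F z) := by
  refine SymForm.transversallyPositive_subset_interior (fun A hA P hP => ?_)
    (fun A hA t ht => ?_) hW
  · have hmem := hF z _ hA P hP
    rwa [← (isLinearMap_symJet z).map_add] at hmem
  · have hmem := hcone z _ hA t ht
    rwa [← (isLinearMap_symJet z).map_smul] at hmem

end Subequation

theorem theoremC3_general
    {E : Type*} [NormedAddCommGroup E] [NormedSpace ℝ E] [FiniteDimensional ℝ E]
    {Z : Type*} [TopologicalSpace Z] [T2Space Z] [SecondCountableTopology Z]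
    [ChartedSpace E Z] [IsManifold 𝓘(ℝ, E) ∞ Z]
    {E' : Type*} [NormedAddCommGroup E'] [NormedSpace ℝ E']
    {X : Type*} [TopologicalSpace X] [ChartedSpace E' X] {n : WithTop ℕ∞} (hn : 2 ≤ n)
    {i : X → Z} (hi : IsSmoothEmbedding 𝓘(ℝ, E') 𝓘(ℝ, E) n i) (hX : IsClosed (range i))
    {F : Set (JetBundle E Z)}
    (hF : ∀ z, ∀ J ∈ jetSlice E F z, ∀ P : SymForm E,
      (∀ v, 0 ≤ P.1 v v) → J + symJet E z P ∈ jetSlice E F z)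
    (hcone : HasConeProperty E F)
    (hint : ∀ x, ∀ A ∈ interior (symSlice E F (i x)),
      (⟨i x, symJet E (i x) A⟩ : JetBundle E Z) ∈ interior F)
    (hfree : IsTotallyFree E F (E' := E') i)
    {u : X → ℝ} (hu : ContMDiff 𝓘(ℝ, E') 𝓘(ℝ, ℝ) 2 u) :
    ∃ (U : Set Z) (f : Z → ℝ), IsOpen U ∧ range i ⊆ U ∧
      IsStrictlySubharmonicOn E F f U ∧ ∀ x, f (i x) = u x := by
  have : LocallyCompactSpace Z := ChartedSpace.locallyCompactSpace E Z
  obtain ⟨w, hwu⟩ := exists_contMDiff_extension 2 hn hi hX hu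
  obtain ⟨g, hg, hgJ⟩ := exists_contMDiff_jetAt_mem_transversallyPositive hn hi hX
  choose P hP hPg using hgJ
  have hgF : ∀ z ∈ range i, (⟨z, jetAt E g z⟩ : JetBundle E Z) ∈ interior F := by
    rintro _ ⟨x, rfl⟩
    exact hPg x ▸ hint x (P x)
      (transversallyPositive_subset_interior_symSlice hF hcone (hfree x) (hP x))
  obtain ⟨l, hl⟩ : ∃ l : C^2⟮𝓘(ℝ, E), Z; 𝓘(ℝ, ℝ), ℝ⟯, ∀ z ∈ range i,
      (⟨z, jetAt E w z + l z • jetAt E g z⟩ : JetBundle E Z) ∈ interior F :=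
    exists_contMDiffMap_add_smul_mem_interior_of_cone 2 hcone hX
      (continuous_jetAt w.contMDiff) (continuous_jetAt hg) hgF
  have hlg : ContMDiff 𝓘(ℝ, E) 𝓘(ℝ, ℝ) 2 (⇑l * g) := l.contMDiff.mul hg
  have hfF : ∀ z ∈ range i, (⟨z, jetAt E (⇑w + ⇑l * g) z⟩ : JetBundle E Z) ∈ interior F := by
    rintro _ ⟨x, rfl⟩
    rw [jetAt_add (w.contMDiff _) (hlg _),
      jetAt_mul_of_critical (l.contMDiff _) (hg _) (hPg x).symm]
    exact hl (i x) ⟨x, rfl⟩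
  obtain ⟨U, hU, hXU, hf⟩ := exists_isStrictlySubharmonicOn (w.contMDiff.add hlg) hfF
  exact ⟨U, _, hU, hXU, hf, fun x => by simp [eq_zero_of_jetAt_eq_symJet (hPg x).symm, hwu]⟩

theorem theoremC3
    {E : Type*} [NormedAddCommGroup E] [NormedSpace ℝ E] [FiniteDimensional ℝ E]
    {Z : Type*} [TopologicalSpace Z] [T2Space Z] [SecondCountableTopology Z]
    [ChartedSpace E Z] [IsManifold 𝓘(ℝ, E) ∞ Z]
    {E' : Type*} [NormedAddCommGroup E'] [NormedSpace ℝ E'] [FiniteDimensional ℝ E']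
    {X : Type*} [TopologicalSpace X] [ChartedSpace E' X] [IsManifold 𝓘(ℝ, E') ∞ X]
    (i : X → Z) (hi : Manifold.IsSmoothEmbedding 𝓘(ℝ, E') 𝓘(ℝ, E) ∞ i)
    (hX : IsClosed (Set.range i))
    (F : Set (JetBundle E Z)) (hF : IsSubequation E F) (hcone : HasConeProperty E F)
    (hint : ∀ x : X, ∀ A ∈ interior (symSlice E F (i x)),
      (⟨i x, symJet E (i x) A⟩ : JetBundle E Z) ∈ interior F)
    (hfree : IsTotallyFree E F (E' := E') i)
    (u : X → ℝ) (hu : ContMDiff 𝓘(ℝ, E') 𝓘(ℝ, ℝ) 2 u) :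
    ∃ (U : Set Z) (f : Z → ℝ), IsOpen U ∧ Set.range i ⊆ U ∧
      IsStrictlySubharmonicOn E F f U ∧ ∀ x : X, f (i x) = u x :=
  theoremC3_general ENat.LEInfty.out hi hX hF.positivity hcone hint hfree hu
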